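/- **Setting.** Let $d\ge 1$, $n\ge 0$ be integers. Let $\mathcal S$ be the real Schwartz space on $\mathbb R^d$ and $\mathcal S'$ its continuous dual, with the distributional derivatives $\partial_i$. For multi-indices $k\in\mathbb Z^d_+$ let $h_k\in\mathcal S$ be the Hermite functions $h_k(x)=\prod_{i=1}^d (2^{k_i}k_i!\sqrt\pi)^{-1/2}H_{k_i}(x_i)e^{-x_i^2/2}$ ($H_m$ the physicists' Hermite polynomials), which form an orthonormal basis of $L^2(\mathbb R^d)$. For $p\in\mathbb R$ the Hermite–Sobolev space is $$\mathcal S_p=\Big\{u\in\mathcal S' : \sum_{k}(2|k|+d)^{2p}\langle u,h_k\rangle^2<\infty\Big\},\qquad \langle u,v\rangle_p=\sum_{k}(2|k|+d)^{2p}\langle u,h_k\rangle\langle v,h_k\rangle,\qquad \|u\|_p=\langle u,u\rangle_p^{1/2},$$ and $B_p(0,\lambda)=\{\phi\in\mathcal S_p:\|\phi\|_p\le\lambda\}$. Let $p,q\in\mathbb R$ with $q\le p-1$. For functions $\sigma_{ij},b_i:\mathcal S_p\to\mathbb R$ ($1\le i\le d$, $1\le j\le n$) put $a_{ij}(\phi)=\sum_{m=1}^n\sigma_{im}(\phi)\sigma_{jm}(\phi)$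 and, for $\phi,\psi\in\mathcal S_p$, $$A_i(\phi,\psi)=-\sum_{k=1}^d\sigma_{ki}(\phi)\,\partial_k\psi\quad(1\le i\le n),\qquad L(\phi,\psi)=\frac12\sum_{i,j=1}^d a_{ij}(\phi)\,\partial^2_{ij}\psi-\sum_{i=1}^d b_i(\phi)\,\partial_i\psi .$$ For $\lambda>0$ let $K_1(\lambda)=\max_{i,j}\sup_{\|\phi\|_p\le\lambda}\{|\sigma_{ij}(\phi)|^2,|b_i(\phi)|\}$. **Theorem 3.3.** For all such $\sigma_{ij},b_i$ and all $\phi,\psi\in\mathcal S_p$ the distributions $L(\phi,\psi)$ and $A_1(\phi,\psi),\dots,A_n(\phi,\psi)$ belong to $\mathcal S_q$. Moreover, for all $\lambda>0$, $K>0$ and $M\ge 0$ there is a constant $C>0$, depending only on $n,d,p,q,\lambda,K,M$, such that the following holds. If $\sigma_{ij},b_i:\mathcal S_p\to\mathbb R$ satisfy $$|\sigma_{ij}(\phi)-\sigma_{ij}(\psi)|\le K\|\phi-\psi\|_q,\qquad |b_i(\phi)-b_i(\psi)|\le K\|\phi-\psi\|_q\qquad\text{for all } i,j \text{ and all }\phi,\psi\in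 B_p(0,\lambda),$$ and $K_1(\lambda)\le M$, then $$2\langle\phi_2-\phi_1,\,L(\phi_3,\phi_2)-L(\phi_2,\phi_1)\rangle_q+\sum_{i=1}^n\|A_i(\phi_3,\phi_2)-A_i(\phi_2,\phi_1)\|_q^2\le C\big(\|\phi_2-\phi_1\|_q^2+\|\phi_2-\phi_3\|_q^2\big)$$ for all $\phi_1,\phi_2,\phi_3\in B_p(0,\lambda)$. -/

import Mathlib

open scoped SchwartzMap NNReal ENNReal

namespace HermiteSobolev

/-- Euclidean space `ℝ^d`. -/
abbrev E (d : ℕ) : Type := EuclideanSpace ℝ (Fin d)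

/-- The space `𝒮'` of real tempered distributions on `ℝ^d`: the continuous dual of the real
Schwartz space. -/
abbrev TDist (d : ℕ) : Type := 𝓢(E d, ℝ) →L[ℝ] ℝ

/-! ### Hermite functions as Schwartz functions -/

theorem gaussian_decay (d k n : ℕ) : ∃ C : ℝ, ∀ x : E d,
    ‖x‖ ^ k * ‖iteratedFDeriv ℝ n (fun y : E d => Real.exp (-‖y‖ ^ 2 / 2)) x‖ ≤ C := by
  have hf : (fun y : E d => -‖y‖ ^ 2 / 2).HasTemperateGrowth := by
    have h := (Function.HasTemperateGrowth.const (E := E d) (-(1 / 2) : ℝ)).mul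
      (Function.hasTemperateGrowth_norm_sq (H := E d))
    have he : (fun y : E d => -‖y‖ ^ 2 / 2) = (fun _ => (-(1 / 2) : ℝ)) * fun y => ‖y‖ ^ 2 := by
      funext y
      simp only [Pi.mul_apply]
      ring
    rw [he]
    exact h
  obtain ⟨m, C, hC, hb⟩ := hf.norm_iteratedFDeriv_le_uniform n
  set C' := max 1 C with hC'
  have key : ∀ x : E d, ‖iteratedFDeriv ℝ n (fun y : E d => Real.exp (-‖y‖ ^ 2 / 2)) x‖
      ≤ n.factorial * Real.exp (-‖x‖ ^ 2 / 2) * (C' * (1 + ‖x‖) ^ m) ^ n := by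
    intro x
    refine norm_iteratedFDeriv_comp_le (g := Real.exp) (f := fun y : E d => -‖y‖ ^ 2 / 2)
      (N := ((⊤ : ℕ∞) : WithTop ℕ∞)) Real.contDiff_exp hf.1 (by exact_mod_cast le_top)
      x ?_ ?_
    · intro i _
      rw [norm_iteratedFDeriv_eq_norm_iteratedDeriv, iteratedDeriv_eq_iterate,
        Real.iter_deriv_exp]
      simp
    · intro i hi hin
      have h1 : 1 ≤ C' * (1 + ‖x‖) ^ m := by
        have h2 : (1 : ℝ) ≤ (1 + ‖x‖) ^ m := one_le_pow₀ (by linarith [norm_nonneg x])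
        have h3 : 1 ≤ C' := le_max_left _ _
        nlinarith
      refine (hb i hin x).trans (le_trans ?_ (le_self_pow₀ h1 (by omega)))
      have : C ≤ C' := le_max_right _ _
      gcongr
  -- a power of `1 + r` times a Gaussian is bounded
  obtain ⟨B, hB⟩ : ∃ B : ℝ, ∀ r : ℝ, 0 ≤ r →
      (1 + r) ^ (k + m * n) * Real.exp (-r ^ 2 / 2) ≤ B := by
    refine ⟨(k + m * n).factorial * Real.exp 2, fun r hr => ?_⟩
    have h1 : (1 + r) ^ (k + m * n) ≤ (k + m * n).factorial * Real.exp (1 + r) := by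
      have := Real.pow_div_factorial_le_exp (1 + r) (by linarith) (k + m * n)
      rwa [div_le_iff₀' (by positivity)] at this
    calc (1 + r) ^ (k + m * n) * Real.exp (-r ^ 2 / 2)
        ≤ (k + m * n).factorial * Real.exp (1 + r) * Real.exp (-r ^ 2 / 2) := by gcongr
      _ = (k + m * n).factorial * Real.exp (1 + r + -r ^ 2 / 2) := by
          rw [mul_assoc, ← Real.exp_add]
      _ ≤ _ := by
          gcongr
          nlinarith [sq_nonneg (r - 1)]
  refine ⟨n.factorial * C' ^ n * B, fun x => ?_⟩
  have hC0 : 0 ≤ C' := le_trans zero_le_one (le_max_left _ _)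
  calc ‖x‖ ^ k * _ ≤ (1 + ‖x‖) ^ k *
        (n.factorial * Real.exp (-‖x‖ ^ 2 / 2) * (C' * (1 + ‖x‖) ^ m) ^ n) := by
        gcongr
        · linarith [norm_nonneg x]
        · exact key x
    _ = n.factorial * C' ^ n * ((1 + ‖x‖) ^ (k + m * n) * Real.exp (-‖x‖ ^ 2 / 2)) := by
        rw [mul_pow, ← pow_mul, pow_add]; ring
    _ ≤ _ := by
        gcongr
        exact hB _ (norm_nonneg x)

/-- The Gaussian `x ↦ exp (-|x|² / 2)` as a Schwartz function. -/
noncomputable def gaussian (d : ℕ) : 𝓢(E d, ℝ) where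
  toFun x := Real.exp (-‖x‖ ^ 2 / 2)
  smooth' := by
    have : ContDiff ℝ ((⊤ : ℕ∞) : WithTop ℕ∞) (fun x : E d => ‖x‖ ^ 2) := contDiff_norm_sq ℝ
    exact Real.contDiff_exp.comp (this.neg.div_const 2)
  decay' := gaussian_decay d

/-- The one-dimensional Hermite function
`h_m(t) = (m! √π)^{-1/2} He_m(√2 t) e^{-t²/2} = (2^m m! √π)^{-1/2} H_m(t) e^{-t²/2}`,
where `He_m` (Mathlib's `Polynomial.hermite`) and `H_m` are the probabilists' and the physicists'
Hermite polynomials. -/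
noncomputable def hermite1 (m : ℕ) (t : ℝ) : ℝ :=
  (Real.sqrt (m.factorial * Real.sqrt Real.pi))⁻¹ *
    Polynomial.aeval (Real.sqrt 2 * t) (Polynomial.hermite m) * Real.exp (-t ^ 2 / 2)

theorem polyPart_hasTemperateGrowth {d : ℕ} (k : Fin d → ℕ) :
    (fun x : E d => ∏ i, ((Real.sqrt ((k i).factorial * Real.sqrt Real.pi))⁻¹ *
      Polynomial.aeval (Real.sqrt 2 * x i) (Polynomial.hermite (k i)))).HasTemperateGrowth := by
  have hcoord : ∀ i : Fin d, (fun x : E d => x i).HasTemperateGrowth := fun i =>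
    (EuclideanSpace.proj i : E d →L[ℝ] ℝ).hasTemperateGrowth
  have h1 : ∀ i : Fin d, (fun x : E d => (Real.sqrt ((k i).factorial * Real.sqrt Real.pi))⁻¹ *
      Polynomial.aeval (Real.sqrt 2 * x i) (Polynomial.hermite (k i))).HasTemperateGrowth := by
    intro i
    refine (Function.HasTemperateGrowth.const _).mul ?_
    simp only [Polynomial.aeval_eq_sum_range]
    refine Function.HasTemperateGrowth.sum fun j _ => ?_
    have h2 := (Function.HasTemperateGrowth.const (E := E d)
      (((Polynomial.hermite (k i)).coeff j : ℤ) : ℝ)).mul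
      (((Function.HasTemperateGrowth.const (E := E d) (Real.sqrt 2)).mul (hcoord i)).pow j)
    convert h2 using 1
    funext x
    simp
  have h3 : ∀ s : Finset (Fin d), (fun x : E d => ∏ i ∈ s,
      ((Real.sqrt ((k i).factorial * Real.sqrt Real.pi))⁻¹ *
      Polynomial.aeval (Real.sqrt 2 * x i) (Polynomial.hermite (k i)))).HasTemperateGrowth := by
    classical
    intro s
    induction s using Finset.induction_on with
    | empty => simp
    | insert a s ha ih =>
      simp only [Finset.prod_insert ha]
      exact (h1 a).mul ih
  exact h3 Finset.univ

theorem hermite_eq_smul_gaussian {d : ℕ} (k : Fin d → ℕ) :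
    (fun x : E d => ∏ i, hermite1 (k i) (x i)) = ⇑(SchwartzMap.smulLeftCLM ℝ
      (fun x : E d => ∏ i, ((Real.sqrt ((k i).factorial * Real.sqrt Real.pi))⁻¹ *
        Polynomial.aeval (Real.sqrt 2 * x i) (Polynomial.hermite (k i)))) (gaussian d)) := by
  funext x
  rw [SchwartzMap.smulLeftCLM_apply_apply (polyPart_hasTemperateGrowth k)]
  change _ = _ • Real.exp (-‖x‖ ^ 2 / 2)
  simp only [hermite1, smul_eq_mul]
  rw [Finset.prod_mul_distrib, ← Real.exp_sum]
  congr 2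
  rw [EuclideanSpace.norm_sq_eq, ← Finset.sum_div, Finset.sum_neg_distrib]
  simp

/-- The Hermite function `h_k(x) = ∏ᵢ h_{kᵢ}(xᵢ)`, `k` a multi-index, as a Schwartz function
on `ℝ^d`. -/
noncomputable def hermiteFn {d : ℕ} (k : Fin d → ℕ) : 𝓢(E d, ℝ) where
  toFun x := ∏ i, hermite1 (k i) (x i)
  smooth' := by rw [hermite_eq_smul_gaussian]; exact SchwartzMap.smooth' _
  decay' := by rw [hermite_eq_smul_gaussian]; exact SchwartzMap.decay' _

/-! ### The Hermite–Sobolev spaces -/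

/-- The weight `(2|k| + d)^{2p}`. -/
noncomputable def weight {d : ℕ} (p : ℝ) (k : Fin d → ℕ) : ℝ :=
  ((2 * ∑ i, k i + d : ℕ) : ℝ) ^ (2 * p)

theorem weight_nonneg {d : ℕ} (p : ℝ) (k : Fin d → ℕ) : 0 ≤ weight p k := by
  unfold weight; positivity

/-- The Hermite–Sobolev space `𝒮_p`, `p ∈ ℝ`, realised inside `𝒮'`: the tempered distributions `u`
with `∑_k (2|k| + d)^{2p} ⟨u, h_k⟩² < ∞`. -/
noncomputable def Sp (d : ℕ) (p : ℝ) : Submodule ℝ (TDist d) where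
  carrier := {u | Summable fun k : Fin d → ℕ => weight p k * u (hermiteFn k) ^ 2}
  zero_mem' := by simp
  add_mem' := by
    intro u v hu hv
    refine Summable.of_nonneg_of_le (fun k => mul_nonneg (weight_nonneg p k) (sq_nonneg _))
      (fun k => ?_) ((hu.add hv).mul_left 2)
    have := mul_nonneg (weight_nonneg p k) (sq_nonneg (u (hermiteFn k) - v (hermiteFn k)))
    change _ * (u (hermiteFn k) + v (hermiteFn k)) ^ 2 ≤ _
    nlinarith
  smul_mem' := by
    intro c u hu
    refine (hu.mul_left (c ^ 2)).congr fun k => ?_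
    change _ = _ * (c * u (hermiteFn k)) ^ 2
    ring

/-- The inner product `⟨u, v⟩_p = ∑_k (2|k| + d)^{2p} ⟨u, h_k⟩ ⟨v, h_k⟩`, meant for
`u, v ∈ 𝒮_p`. -/
noncomputable def innerP {d : ℕ} (p : ℝ) (u v : TDist d) : ℝ :=
  ∑' k : Fin d → ℕ, weight p k * u (hermiteFn k) * v (hermiteFn k)

/-- The norm `‖u‖_p = ⟨u, u⟩_p^{1/2}`, meant for `u ∈ 𝒮_p`. -/
noncomputable def normP {d : ℕ} (p : ℝ) (u : TDist d) : ℝ :=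
  Real.sqrt (innerP p u u)

/-- On `𝒮_p` the series defining the inner product converges. -/
theorem summable_innerP {d : ℕ} {p : ℝ} {u v : TDist d} (hu : u ∈ Sp d p) (hv : v ∈ Sp d p) :
    Summable fun k : Fin d → ℕ => weight p k * u (hermiteFn k) * v (hermiteFn k) := by
  have hu' : Summable fun k : Fin d → ℕ => weight p k * u (hermiteFn k) ^ 2 := hu
  have hv' : Summable fun k : Fin d → ℕ => weight p k * v (hermiteFn k) ^ 2 := hv
  refine Summable.of_norm_bounded (hu'.add hv') fun k => ?_
  rw [Real.norm_eq_abs, abs_le]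
  have h1 := mul_nonneg (weight_nonneg p k) (sq_nonneg (u (hermiteFn k) - v (hermiteFn k)))
  have h2 := mul_nonneg (weight_nonneg p k) (sq_nonneg (u (hermiteFn k) + v (hermiteFn k)))
  have h3 := mul_nonneg (weight_nonneg p k) (sq_nonneg (u (hermiteFn k)))
  have h4 := mul_nonneg (weight_nonneg p k) (sq_nonneg (v (hermiteFn k)))
  constructor <;> nlinarith

/-- `𝒮_p ⊆ 𝒮_q` for `q ≤ p`. -/
theorem Sp_mono {d : ℕ} (hd : 1 ≤ d) {p q : ℝ} (hqp : q ≤ p) : Sp d p ≤ Sp d q := by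
  intro u hu
  refine Summable.of_nonneg_of_le (fun k => mul_nonneg (weight_nonneg q k) (sq_nonneg _))
    (fun k => ?_) hu
  refine mul_le_mul_of_nonneg_right ?_ (sq_nonneg _)
  unfold weight
  refine Real.rpow_le_rpow_of_exponent_le ?_ (by linarith)
  exact_mod_cast (by omega : 1 ≤ 2 * ∑ i, k i + d)

/-! ### The operators -/

/-- The distributional partial derivative `∂_i` on `𝒮'`: `⟨∂_i u, f⟩ = -⟨u, ∂_i f⟩`. -/
noncomputable def partialD {d : ℕ} (i : Fin d) (u : TDist d) : TDist d :=
  -(u.comp (LineDeriv.lineDerivOpCLM ℝ 𝓢(E d, ℝ) (EuclideanSpace.single i (1 : ℝ))))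

/-- `A_i(φ, ψ) = - ∑_k σ_{ki}(φ) ∂_k ψ`. -/
noncomputable def opA {d n : ℕ} {p : ℝ} (σ : Fin d → Fin n → Sp d p → ℝ) (i : Fin n)
    (φ ψ : Sp d p) : TDist d :=
  -∑ k, σ k i φ • partialD k (ψ : TDist d)

/-- `a_{ij}(φ) = (σ(φ) σ(φ)ᵗ)_{ij}`. -/
noncomputable def coeffA {d n : ℕ} {p : ℝ} (σ : Fin d → Fin n → Sp d p → ℝ) (i j : Fin d)
    (φ : Sp d p) : ℝ :=
  ∑ m, σ i m φ * σ j m φ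

/-- `L(φ, ψ) = ½ ∑_{i,j} a_{ij}(φ) ∂²_{ij} ψ - ∑_i b_i(φ) ∂_i ψ`. -/
noncomputable def opL {d n : ℕ} {p : ℝ} (σ : Fin d → Fin n → Sp d p → ℝ)
    (b : Fin d → Sp d p → ℝ) (φ ψ : Sp d p) : TDist d :=
  (1 / 2 : ℝ) • (∑ i, ∑ j, coeffA σ i j φ • partialD i (partialD j (ψ : TDist d)))
    - ∑ i, b i φ • partialD i (ψ : TDist d)

/-- The closed ball `B_p(0, r) = {φ ∈ 𝒮_p : ‖φ‖_p ≤ r}`. -/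
def ballP (d : ℕ) (p r : ℝ) : Set (Sp d p) := {φ | normP p (φ : TDist d) ≤ r}

/-- `K₁(r) = max_{i,j} sup_{‖φ‖_p ≤ r} {|σ_{ij}(φ)|², |b_i(φ)|}`, as an extended nonnegative
number. -/
noncomputable def K₁ {d n : ℕ} {p : ℝ} (σ : Fin d → Fin n → Sp d p → ℝ)
    (b : Fin d → Sp d p → ℝ) (r : ℝ) : ℝ≥0∞ :=
  ⨆ φ ∈ ballP d p r, max (⨆ i, ⨆ j, ENNReal.ofReal (|σ i j φ| ^ 2)) (⨆ i, ENNReal.ofReal |b i φ|)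

/-- All `σ_{ij}` and `b_i` are Lipschitz on `B_p(0, r)` with respect to the weaker norm `‖·‖_q`,
with constant `K`. -/
def LipschitzOnBall {d n : ℕ} {p : ℝ} (q r K : ℝ) (σ : Fin d → Fin n → Sp d p → ℝ)
    (b : Fin d → Sp d p → ℝ) : Prop :=
  ∀ φ ∈ ballP d p r, ∀ ψ ∈ ballP d p r,
    (∀ i j, |σ i j φ - σ i j ψ| ≤ K * normP q ((φ - ψ : Sp d p) : TDist d)) ∧
    (∀ i, |b i φ - b i ψ| ≤ K * normP q ((φ - ψ : Sp d p) : TDist d))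

end HermiteSobolev

open HermiteSobolev

namespace HermiteSobolev

/-! ### Derivatives of Hermite functions -/

/-! Put `u = φ₂ - φ₁`. The differences of `L` and of `A_i` split into increments of the
coefficients, acting on `φ₂`, and the coefficients frozen at `φ₂`, acting on `u`. The increments are
`O(‖φ₂ - φ₃‖_q)`, and `φ₂` is bounded in `𝒮_p`, which leaves room for two derivatives in `𝒮_q`. The
derivatives of `u`, however, are not controlled by `‖u‖_q`.

What saves the estimate is that `∂_i` is almost skew-adjoint on `𝒮_q`: `⟨∂_i u, v⟩_q + ⟨u, ∂_i v⟩_q`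
is at most a constant times `‖u‖_q ‖v‖_{q-1/2}` (`innerP_partialD_add_le`). Since `∂_j` costs half
an order (`partialD_mem_and_norm_le`), the choice `v = ∂_j u` bounds `⟨u, ∂_i ∂_j u⟩_q + ⟨∂_i u, ∂_j
u⟩_q` by `‖u‖_q²`. This is the combination formed by the second-order part of `L` and the squares of
the `A_i`. The choice `v = u` handles the drift, and `v = ∂_j φ₂` the cross terms.

Both facts are read off Hermite coefficients. The ladder relation turns `∂_i` into two shifts with
coefficients of size `(2|k| + d)^{1/2}`; after reindexing, the near skew-adjointness reduces to the
weight increment `N^{2q} - (N + 2)^{2q} = O(N^{2q-1})`. -/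

theorem derivative_hermite_succ (n : ℕ) :
    Polynomial.derivative (Polynomial.hermite (n + 1))
      = (n + 1 : Polynomial ℤ) * Polynomial.hermite n := by
  induction n with
  | zero => simp
  | succ n ih =>
    have h := congrArg Polynomial.derivative ih
    simp only [Polynomial.derivative_mul, Polynomial.derivative_add, Polynomial.derivative_one,
      Polynomial.derivative_natCast] at h
    rw [Polynomial.hermite_succ (n + 1), Polynomial.derivative_sub, Polynomial.derivative_mul,
      Polynomial.derivative_X, h, ih]
    have h2 := Polynomial.hermite_succ n
    push_cast
    linear_combination (-(n + 1 : Polynomial ℤ)) * h2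

/-- The normalising constant of the Hermite function `h_m`. -/
noncomputable def hermiteCoeff (m : ℕ) : ℝ := (Real.sqrt (m.factorial * Real.sqrt Real.pi))⁻¹

theorem hermiteCoeff_succ (m : ℕ) :
    hermiteCoeff m = Real.sqrt (m + 1) * hermiteCoeff (m + 1) := by
  have h1 : (0 : ℝ) < Real.sqrt (m + 1) := Real.sqrt_pos.2 (by positivity)
  unfold hermiteCoeff
  rw [Nat.factorial_succ, Nat.cast_mul, mul_assoc ((m + 1 : ℕ) : ℝ),
    Real.sqrt_mul (by positivity) (_ * _), mul_inv (Real.sqrt _), ← mul_assoc, Nat.cast_succ,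
    mul_inv_cancel₀ h1.ne', one_mul]

/-- The ladder relation `h_m' = √(m/2) h_{m-1} - √((m+1)/2) h_{m+1}`. -/
theorem hasDerivAt_hermite1 (m : ℕ) (t : ℝ) :
    HasDerivAt (hermite1 m) (Real.sqrt (m / 2) * hermite1 (m - 1) t
      - Real.sqrt ((m + 1 : ℕ) / 2) * hermite1 (m + 1) t) t := by
  have h2 : Real.sqrt 2 ^ 2 = 2 := Real.sq_sqrt (by norm_num)
  have h2' : Real.sqrt 2 ≠ 0 := by positivity
  have hP : HasDerivAt (fun t : ℝ => Polynomial.aeval (Real.sqrt 2 * t) (Polynomial.hermite m))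
      (Polynomial.aeval (Real.sqrt 2 * t) (Polynomial.derivative (Polynomial.hermite m))
        * Real.sqrt 2) t := by
    have := (Polynomial.hasDerivAt_aeval (Polynomial.hermite m) (Real.sqrt 2 * t)).comp t
      ((hasDerivAt_id t).const_mul (Real.sqrt 2))
    simpa [Function.comp_def] using this
  have hE : HasDerivAt (fun t : ℝ => Real.exp (-t ^ 2 / 2)) (Real.exp (-t ^ 2 / 2) * (-t)) t := by
    have := (((hasDerivAt_id t).pow 2).neg.div_const 2).exp
    convert this using 1
    simp only [Pi.neg_apply, Pi.pow_apply, id]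
    norm_num
    ring
  have hmain := (hP.const_mul (hermiteCoeff m)).mul hE
  refine hmain.congr_deriv ?_
  -- The recurrence `He_{m+1} = X He_m - He_m'` eliminates the factor `t` produced by the Gaussian,
  -- leaving `(He_m' - He_{m+1}) / √2`.
  have hs := congrArg (Polynomial.aeval (Real.sqrt 2 * t)) (Polynomial.hermite_succ m)
  simp only [map_sub, map_mul, Polynomial.aeval_X] at hs
  have hc := hermiteCoeff_succ m
  have hsm : Real.sqrt ((m + 1 : ℕ) / 2) = Real.sqrt (m + 1) / Real.sqrt 2 := by
    rw [Real.sqrt_div (by positivity)]; push_cast; rfl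
  have e1 : Real.sqrt ((m + 1 : ℕ) / 2) * hermite1 (m + 1) t = hermiteCoeff m / Real.sqrt 2 *
      Polynomial.aeval (Real.sqrt 2 * t) (Polynomial.hermite (m + 1)) *
      Real.exp (-t ^ 2 / 2) := by
    rw [hsm, hc]
    unfold hermite1
    change _ * (hermiteCoeff (m + 1) * _ * _) = _
    ring
  have e2 : Real.sqrt (m / 2) * hermite1 (m - 1) t = hermiteCoeff m / Real.sqrt 2 *
      Polynomial.aeval (Real.sqrt 2 * t) (Polynomial.derivative (Polynomial.hermite m)) *
      Real.exp (-t ^ 2 / 2) := by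
    -- For `m = 0` the truncated index `m - 1` is harmless: its coefficient `√(0/2)` vanishes, as
    -- does `He_0'`.
    cases m with
    | zero => simp
    | succ m =>
      have hc' := hermiteCoeff_succ m
      rw [derivative_hermite_succ]
      have hq : Real.sqrt (m + 1) * Real.sqrt (m + 1) = m + 1 :=
        Real.mul_self_sqrt (by positivity)
      unfold hermite1
      change _ * (hermiteCoeff m * _ * _) = _
      rw [Real.sqrt_div (by positivity), hc']
      simp only [map_mul, map_add, map_natCast, map_one, Nat.cast_add, Nat.cast_one,
        Nat.add_sub_cancel]
      linear_combination (Real.sqrt 2)⁻¹ * hermiteCoeff (m + 1) *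
        Polynomial.aeval (Real.sqrt 2 * t) (Polynomial.hermite m) * Real.exp (-t ^ 2 / 2) * hq
  rw [e1, e2, hs]
  field_simp
  linear_combination hermiteCoeff m *
    Polynomial.aeval (Real.sqrt 2 * t) (Polynomial.derivative (Polynomial.hermite m)) * h2

/-- Moving along the `i`-th axis changes only the `i`-th factor of the product, so the
one-dimensional ladder relation applies. Truncated subtraction at `k i = 0` is again masked by a
zero coefficient. -/
theorem lineDerivOp_hermiteFn {d : ℕ} (i : Fin d) (k : Fin d → ℕ) :
    LineDeriv.lineDerivOpCLM ℝ 𝓢(E d, ℝ) (EuclideanSpace.single i (1 : ℝ)) (hermiteFn k)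
      = Real.sqrt (k i / 2) • hermiteFn (k - Pi.single i 1)
        - Real.sqrt ((k i + 1 : ℕ) / 2) • hermiteFn (k + Pi.single i 1) := by
  ext x
  rw [LineDeriv.lineDerivOpCLM_apply, SchwartzMap.lineDerivOp_apply]
  have hprod : ∀ (l : Fin d → ℕ) (y : E d), hermiteFn l y
      = hermite1 (l i) (y i) * ∏ j ∈ Finset.univ.erase i, hermite1 (l j) (y j) := fun l y =>
    (Finset.mul_prod_erase Finset.univ (fun j => hermite1 (l j) (y j)) (Finset.mem_univ i)).symm
  have hP : ∀ l : Fin d → ℕ, (∀ j, j ≠ i → l j = k j) →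
      ∏ j ∈ Finset.univ.erase i, hermite1 (l j) (x j)
        = ∏ j ∈ Finset.univ.erase i, hermite1 (k j) (x j) := fun l hl =>
    Finset.prod_congr rfl fun j hj => by rw [hl j (Finset.ne_of_mem_erase hj)]
  have hline : (fun t : ℝ => hermiteFn k (x + t • EuclideanSpace.single i (1 : ℝ)))
      = fun t : ℝ => hermite1 (k i) (x i + t)
        * ∏ j ∈ Finset.univ.erase i, hermite1 (k j) (x j) := by
    funext t
    rw [hprod]
    congr 1
    · simp
    · refine Finset.prod_congr rfl fun j hj => ?_
      have := Finset.ne_of_mem_erase hj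
      simp [this]
  have hd : HasLineDerivAt ℝ (hermiteFn k)
      ((Real.sqrt (k i / 2) * hermite1 (k i - 1) (x i)
        - Real.sqrt ((k i + 1 : ℕ) / 2) * hermite1 (k i + 1) (x i))
        * ∏ j ∈ Finset.univ.erase i, hermite1 (k j) (x j)) x
      (EuclideanSpace.single i (1 : ℝ)) := by
    unfold HasLineDerivAt
    rw [hline]
    have h := (HasDerivAt.comp_const_add (x i) 0 (hasDerivAt_hermite1 (k i) (x i + 0))).mul_const
      (∏ j ∈ Finset.univ.erase i, hermite1 (k j) (x j))
    simpa only [add_zero] using h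
  rw [hd.lineDeriv]
  simp only [sub_apply, smul_apply, smul_eq_mul]
  rw [hprod, hprod (k + _), hP (k - _) fun j hj => by simp [hj],
    hP (k + _) fun j hj => by simp [hj]]
  simp
  ring

/-- Hermite coefficients of a distributional derivative. -/
theorem partialD_hermiteFn {d : ℕ} (i : Fin d) (u : TDist d) (k : Fin d → ℕ) :
    partialD i u (hermiteFn k) = Real.sqrt ((k i + 1 : ℕ) / 2) * u (hermiteFn (k + Pi.single i 1))
      - Real.sqrt (k i / 2) * u (hermiteFn (k - Pi.single i 1)) := by
  change -(u (LineDeriv.lineDerivOpCLM ℝ 𝓢(E d, ℝ) (EuclideanSpace.single i (1 : ℝ))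
    (hermiteFn k))) = _
  rw [lineDerivOp_hermiteFn, map_sub, map_smul, map_smul]
  simp

/-! ### Elementary estimates -/

/-- Meant for `x = N + 2` with `N ≥ 1`: a unit shift of the multi-index changes any power of the
frequency by a bounded factor, whatever the sign of the exponent. -/
theorem rpow_comparable {N x : ℝ} (hN : 0 < N) (h1 : N ≤ x) (h3 : x ≤ 3 * N) (r : ℝ) :
    x ^ r ≤ 3 ^ |r| * N ^ r ∧ N ^ r ≤ 3 ^ |r| * x ^ r := by
  have hx : 0 < x := hN.trans_le h1
  have hone : (1 : ℝ) ≤ 3 ^ |r| := Real.one_le_rpow (by norm_num) (abs_nonneg r)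
  rcases le_total 0 r with hr | hr
  · have hm := Real.rpow_le_rpow hN.le h1 hr
    refine ⟨?_, hm.trans (le_mul_of_one_le_left (by positivity) hone)⟩
    rw [abs_of_nonneg hr, ← Real.mul_rpow (by norm_num) hN.le]
    exact Real.rpow_le_rpow hx.le h3 hr
  · have hm := Real.rpow_le_rpow_of_nonpos hN h1 hr
    refine ⟨hm.trans (le_mul_of_one_le_left (by positivity) hone), ?_⟩
    have h := Real.rpow_le_rpow_of_nonpos hx h3 hr
    rw [Real.mul_rpow (by norm_num) hN.le] at h
    rw [abs_of_nonpos hr, Real.rpow_neg (by norm_num)]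
    have h3r : (0 : ℝ) < 3 ^ r := by positivity
    rwa [inv_mul_eq_div, le_div_iff₀' h3r]

/-- Mean value inequality on `[N, N + 2]`. The gain of one power of `N` is the source of the near
skew-adjointness of `∂_i`. -/
theorem abs_rpow_add_two_sub_le {N : ℝ} (hN : 1 ≤ N) (s : ℝ) :
    |N ^ s - (N + 2) ^ s| ≤ 2 * |s| * 3 ^ |s - 1| * N ^ (s - 1) := by
  have hN0 : 0 < N := by linarith
  have h := Convex.norm_image_sub_le_of_norm_hasDerivWithin_le (f := fun x : ℝ => x ^ s)
    (f' := fun x => s * x ^ (s - 1)) (s := Set.Icc N (N + 2)) (x := N + 2) (y := N)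
    (C := |s| * (3 ^ |s - 1| * N ^ (s - 1)))
    (fun x hx => (Real.hasDerivAt_rpow_const (Or.inl (by linarith [hx.1]))).hasDerivWithinAt)
    (fun x hx => by
      have hx0 : 0 < x := hN0.trans_le hx.1
      rw [Real.norm_eq_abs, abs_mul, abs_of_nonneg (Real.rpow_nonneg hx0.le _)]
      gcongr
      exact (rpow_comparable hN0 hx.1 (by linarith [hx.2]) _).1)
    (convex_Icc _ _) ⟨by linarith, le_rfl⟩ ⟨le_rfl, by linarith⟩
  rw [Real.norm_eq_abs, Real.norm_eq_abs] at h
  refine h.trans (le_of_eq ?_)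
  rw [show N - (N + 2) = -2 by ring]
  norm_num
  ring

theorem summable_and_abs_tsum_le {ι : Type*} {f g h : ι → ℝ} {C : ℝ}
    (hf : Summable fun k => f k ^ 2) (hg : Summable fun k => g k ^ 2) (hC : 0 ≤ C)
    (hh : ∀ k, |h k| ≤ C * (|f k| * |g k|)) :
    Summable h ∧ |∑' k, h k| ≤ C * (Real.sqrt (∑' k, f k ^ 2) * Real.sqrt (∑' k, g k ^ 2)) := by
  obtain ⟨h1, h2⟩ := Real.summable_and_inner_le_Lp_mul_Lq_tsum_of_nonneg
    (f := fun k => |f k|) (g := fun k => |g k|) (p := 2) (q := 2)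
    (by rw [Real.holderConjugate_iff]; norm_num) (fun _ => abs_nonneg _) (fun _ => abs_nonneg _)
    (by simpa using hf) (by simpa using hg)
  have hs : Summable h := Summable.of_norm_bounded (h1.mul_left C) hh
  refine ⟨hs, ?_⟩
  have h3 : |∑' k, h k| ≤ ∑' k, C * (|f k| * |g k|) := by
    rw [← Real.norm_eq_abs]
    exact tsum_of_norm_bounded (h1.mul_left C).hasSum hh
  rw [tsum_mul_left] at h3
  refine h3.trans (mul_le_mul_of_nonneg_left ?_ hC)
  simpa [Real.sqrt_eq_rpow] using h2

/-! ### Weights and shifts of multi-indices -/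

/-- The Hermite eigenvalue `2|k| + d`. -/
noncomputable def freq {d : ℕ} (k : Fin d → ℕ) : ℝ := ((2 * ∑ i, k i + d : ℕ) : ℝ)

theorem one_le_freq {d : ℕ} (hd : 1 ≤ d) (k : Fin d → ℕ) : 1 ≤ freq k := by
  unfold freq
  exact_mod_cast (by omega : 1 ≤ 2 * ∑ i, k i + d)

theorem freq_add_single {d : ℕ} (k : Fin d → ℕ) (i : Fin d) :
    freq (k + Pi.single i 1) = freq k + 2 := by
  unfold freq
  simp only [Pi.add_apply, Finset.sum_add_distrib, Finset.sum_pi_single', Finset.mem_univ, if_true]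
  push_cast
  ring

theorem succ_le_freq {d : ℕ} (k : Fin d → ℕ) (i : Fin d) : ((k i + 1 : ℕ) : ℝ) ≤ freq k := by
  unfold freq
  have h1 : k i ≤ ∑ j, k j := Finset.single_le_sum (fun j _ => Nat.zero_le _) (Finset.mem_univ i)
  have h2 : 1 ≤ d := i.pos
  exact_mod_cast (by omega : k i + 1 ≤ 2 * ∑ i, k i + d)

theorem sqrt_succ_le {d : ℕ} (k : Fin d → ℕ) (i : Fin d) :
    Real.sqrt ((k i + 1 : ℕ) / 2) ≤ freq k ^ (1 / 2 : ℝ) := by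
  rw [← Real.sqrt_eq_rpow]
  refine Real.sqrt_le_sqrt ((div_le_self (by positivity) (by norm_num)).trans (succ_le_freq k i))

theorem weight_eq_sq {d : ℕ} (hd : 1 ≤ d) (r : ℝ) (k : Fin d → ℕ) :
    weight r k = (freq k ^ r) ^ 2 := by
  have h : 0 ≤ freq k := zero_le_one.trans (one_le_freq hd k)
  rw [← Real.rpow_natCast, ← Real.rpow_mul h]
  change freq k ^ (2 * r) = _
  rw [mul_comm]
  rfl

theorem add_single_injective {d : ℕ} (i : Fin d) :
    Function.Injective fun k : Fin d → ℕ => k + Pi.single i 1 := add_left_injective _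

theorem mem_range_add_single {d : ℕ} {i : Fin d} {k : Fin d → ℕ} (h : k i ≠ 0) :
    k ∈ Set.range fun k : Fin d → ℕ => k + Pi.single i 1 := by
  refine ⟨k - Pi.single i 1, ?_⟩
  funext j
  rcases eq_or_ne j i with rfl | hj
  · simp; omega
  · simp [hj]

theorem mem_Sp_iff {d : ℕ} (hd : 1 ≤ d) {r : ℝ} {u : TDist d} :
    u ∈ Sp d r ↔ Summable fun k : Fin d → ℕ => (freq k ^ r * u (hermiteFn k)) ^ 2 := by
  simp only [mul_pow, ← weight_eq_sq hd]
  rfl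

theorem normP_eq {d : ℕ} (hd : 1 ≤ d) (r : ℝ) (u : TDist d) :
    normP r u = Real.sqrt (∑' k : Fin d → ℕ, (freq k ^ r * u (hermiteFn k)) ^ 2) := by
  unfold normP innerP
  congr 1
  refine tsum_congr fun k => ?_
  rw [weight_eq_sq hd]
  ring

theorem normP_nonneg {d : ℕ} (r : ℝ) (u : TDist d) : 0 ≤ normP r u := Real.sqrt_nonneg _

theorem normP_mono {d : ℕ} (hd : 1 ≤ d) {r t : ℝ} (hrt : t ≤ r) {u : TDist d} (hu : u ∈ Sp d r) :
    normP t u ≤ normP r u := by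
  rw [normP_eq hd, normP_eq hd]
  refine Real.sqrt_le_sqrt (Summable.tsum_le_tsum (fun k => ?_)
    ((mem_Sp_iff hd).1 (Sp_mono hd hrt hu)) ((mem_Sp_iff hd).1 hu))
  rw [mul_pow, mul_pow]
  have h := Real.rpow_le_rpow_of_exponent_le (one_le_freq hd k) hrt
  have h0 : 0 ≤ freq k ^ t := Real.rpow_nonneg (zero_le_one.trans (one_le_freq hd k)) _
  gcongr

theorem freq_shift {d : ℕ} (hd : 1 ≤ d) (k : Fin d → ℕ) (i : Fin d) (r : ℝ) :
    freq (k + Pi.single i 1) ^ r ≤ 3 ^ |r| * freq k ^ r ∧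
      freq k ^ r ≤ 3 ^ |r| * freq (k + Pi.single i 1) ^ r := by
  have h := one_le_freq hd k
  rw [freq_add_single]
  exact rpow_comparable (by linarith) (by linarith) (by linarith) r

/-- The shift is injective, so reindexing only discards nonnegative terms; `3 ^ |r|` pays for moving
the weight. -/
theorem summable_shift {d : ℕ} (hd : 1 ≤ d) {r : ℝ} {u : TDist d} (hu : u ∈ Sp d r) (i : Fin d) :
    (Summable fun k : Fin d → ℕ => (freq k ^ r * u (hermiteFn (k + Pi.single i 1))) ^ 2) ∧
    Real.sqrt (∑' k : Fin d → ℕ, (freq k ^ r * u (hermiteFn (k + Pi.single i 1))) ^ 2)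
      ≤ 3 ^ |r| * normP r u := by
  have hS := (mem_Sp_iff hd).1 hu
  have hT := hS.comp_injective (add_single_injective i)
  have hle : ∀ k : Fin d → ℕ, (freq k ^ r * u (hermiteFn (k + Pi.single i 1))) ^ 2
      ≤ (3 ^ |r|) ^ 2 * (freq (k + Pi.single i 1) ^ r
        * u (hermiteFn (k + Pi.single i 1))) ^ 2 := by
    intro k
    rw [mul_pow, mul_pow (freq (_ + _) ^ r), ← mul_assoc, ← mul_pow (3 ^ |r|)]
    have h0 : 0 ≤ freq k ^ r := Real.rpow_nonneg (zero_le_one.trans (one_le_freq hd k)) _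
    have h := (freq_shift hd k i r).2
    gcongr
  have hs := Summable.of_nonneg_of_le (fun k => sq_nonneg _) hle (hT.mul_left _)
  refine ⟨hs, ?_⟩
  rw [normP_eq hd, ← Real.sqrt_sq (show (0 : ℝ) ≤ 3 ^ |r| by positivity),
    ← Real.sqrt_mul (by positivity)]
  refine Real.sqrt_le_sqrt ((hs.tsum_le_tsum hle (hT.mul_left _)).trans ?_)
  rw [tsum_mul_left]
  refine mul_le_mul_of_nonneg_left ?_ (sq_nonneg _)
  exact tsum_comp_le_tsum_of_inj hS (fun k => sq_nonneg _) (add_single_injective i)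

/-- Weighted pairing of a distribution with a shift of another one. -/
theorem shift_pairing {d : ℕ} (hd : 1 ≤ d) {r t C : ℝ} (hC : 0 ≤ C) (i : Fin d)
    {c : (Fin d → ℕ) → ℝ} (hc : ∀ k, |c k| ≤ C * freq k ^ (r + t)) {u v : TDist d}
    (hu : u ∈ Sp d r) (hv : v ∈ Sp d t) :
    (Summable fun k => c k * (u (hermiteFn (k + Pi.single i 1)) * v (hermiteFn k))) ∧
    |∑' k, c k * (u (hermiteFn (k + Pi.single i 1)) * v (hermiteFn k))|
      ≤ C * 3 ^ |r| * (normP r u * normP t v) := by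
  obtain ⟨h1, h2⟩ := summable_shift hd hu i
  obtain ⟨h3, h4⟩ := summable_and_abs_tsum_le h1 ((mem_Sp_iff hd).1 hv) hC
    (h := fun k => c k * (u (hermiteFn (k + Pi.single i 1)) * v (hermiteFn k))) (fun k => by
      have hN := zero_lt_one.trans_le (one_le_freq hd k)
      rw [abs_mul, abs_mul, abs_mul, abs_mul, abs_of_pos (Real.rpow_pos_of_pos hN r),
        abs_of_pos (Real.rpow_pos_of_pos hN t)]
      refine (mul_le_mul_of_nonneg_right (hc k) (by positivity)).trans (le_of_eq ?_)
      rw [Real.rpow_add hN]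
      ring)
  refine ⟨h3, h4.trans ?_⟩
  rw [← normP_eq hd, mul_assoc, ← mul_assoc (3 ^ |r|)]
  have := normP_nonneg t v
  gcongr

/-! ### Derivatives on the Hermite–Sobolev scale -/

/-- Such a `G` is supported on the range of the shift. Lowering terms qualify because they carry the
factor `√(k i / 2)`. -/
theorem summable_iff_and_tsum_shift {d : ℕ} {i : Fin d} {G : (Fin d → ℕ) → ℝ}
    (hG : ∀ k : Fin d → ℕ, k i = 0 → G k = 0) :
    (Summable (fun k : Fin d → ℕ => G (k + Pi.single i 1)) ↔ Summable G) ∧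
      ∑' k : Fin d → ℕ, G (k + Pi.single i 1) = ∑' k, G k := by
  have hsub : ∀ k ∉ Set.range (fun k : Fin d → ℕ => k + Pi.single i 1), G k = 0 := fun k hk =>
    hG k (by_contra fun h => hk (mem_range_add_single h))
  exact ⟨(add_single_injective i).summable_iff hsub,
    (add_single_injective i).tsum_eq fun k hk => by_contra fun h => hk (hsub k h)⟩

/-- Both ladder coefficients grow like the square root of the frequency, hence the loss of half an
order. The raised term is a shifted copy of `u` (constant `A`); the lowered one is reindexed first,
which shifts the weight instead (constant `B`). -/
theorem partialD_mem_and_norm_le {d : ℕ} (hd : 1 ≤ d) (r : ℝ) :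
    ∃ C : ℝ, 0 ≤ C ∧ ∀ (i : Fin d) (u : TDist d), u ∈ Sp d r →
      partialD i u ∈ Sp d (r - 1 / 2) ∧ normP (r - 1 / 2) (partialD i u) ≤ C * normP r u := by
  set A : ℝ := 3 ^ |r|
  set B : ℝ := 3 ^ |r - 1 / 2|
  refine ⟨Real.sqrt (2 * A ^ 2 + 2 * B ^ 2), Real.sqrt_nonneg _, fun i u hu => ?_⟩
  have hN : ∀ k : Fin d → ℕ, 0 < freq k := fun k => zero_lt_one.trans_le (one_le_freq hd k)
  have hpow : ∀ k : Fin d → ℕ, freq k ^ (r - 1 / 2) * freq k ^ (1 / 2 : ℝ) = freq k ^ r :=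
    fun k => by rw [← Real.rpow_add (hN k)]; congr 1; ring
  have hS := (mem_Sp_iff hd).1 hu
  obtain ⟨hF, hFle⟩ := summable_shift hd hu i
  have hnu : ∑' k : Fin d → ℕ, (freq k ^ r * u (hermiteFn k)) ^ 2 = normP r u ^ 2 := by
    rw [normP_eq hd, Real.sq_sqrt (tsum_nonneg fun k => sq_nonneg _)]
  have hF' : ∑' k : Fin d → ℕ, (freq k ^ r * u (hermiteFn (k + Pi.single i 1))) ^ 2
      ≤ A ^ 2 * normP r u ^ 2 := by
    rw [← mul_pow]
    exact (Real.sqrt_le_left (mul_nonneg (by positivity) (normP_nonneg _ _))).1 hFle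
  set G : (Fin d → ℕ) → ℝ := fun k =>
    (freq k ^ (r - 1 / 2) * (Real.sqrt (k i / 2) * u (hermiteFn (k - Pi.single i 1)))) ^ 2 with hGdef
  obtain ⟨hG1, hG2⟩ := summable_iff_and_tsum_shift (i := i) (G := G) (fun k hk => by
    simp [hGdef, hk])
  have hGle : ∀ k, G (k + Pi.single i 1) ≤ B ^ 2 * (freq k ^ r * u (hermiteFn k)) ^ 2 := by
    intro k
    have h1 := (freq_shift hd k i (r - 1 / 2)).1
    have h2 := sqrt_succ_le k i
    have h3 : freq (k + Pi.single i 1) ^ (r - 1 / 2) * Real.sqrt ((k i + 1 : ℕ) / 2)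
        ≤ B * freq k ^ r := by
      rw [← hpow, ← mul_assoc]
      have := hN k
      gcongr
    have h4 : 0 ≤ freq (k + Pi.single i 1) ^ (r - 1 / 2) * Real.sqrt ((k i + 1 : ℕ) / 2) :=
      mul_nonneg (Real.rpow_nonneg (hN _).le _) (Real.sqrt_nonneg _)
    simp only [hGdef, add_tsub_cancel_right, Pi.add_apply, Pi.single_eq_same]
    rw [← mul_assoc, mul_pow, mul_pow (freq k ^ r), ← mul_assoc, ← mul_pow B]
    gcongr
  have hGs' := Summable.of_nonneg_of_le (fun k => sq_nonneg _) hGle (hS.mul_left (B ^ 2))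
  have hGs := hG1.1 hGs'
  have hGt : ∑' k, G k ≤ B ^ 2 * normP r u ^ 2 := by
    rw [← hG2, ← hnu, ← tsum_mul_left]
    exact hGs'.tsum_le_tsum hGle (hS.mul_left _)
  have hle : ∀ k : Fin d → ℕ, (freq k ^ (r - 1 / 2) * partialD i u (hermiteFn k)) ^ 2
      ≤ 2 * (freq k ^ r * u (hermiteFn (k + Pi.single i 1))) ^ 2 + 2 * G k := by
    intro k
    rw [partialD_hermiteFn]
    have h1 : (freq k ^ (r - 1 / 2) * (Real.sqrt ((k i + 1 : ℕ) / 2)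
        * u (hermiteFn (k + Pi.single i 1)))) ^ 2
        ≤ (freq k ^ r * u (hermiteFn (k + Pi.single i 1))) ^ 2 := by
      have h2 := sqrt_succ_le k i
      have := hN k
      rw [← mul_assoc, mul_pow, mul_pow _ (u _), ← hpow]
      gcongr
    have h2 := sq_nonneg (freq k ^ (r - 1 / 2) * (Real.sqrt ((k i + 1 : ℕ) / 2)
        * u (hermiteFn (k + Pi.single i 1))) + freq k ^ (r - 1 / 2) *
        (Real.sqrt (k i / 2) * u (hermiteFn (k - Pi.single i 1))))
    simp only [hGdef]
    nlinarith
  have hsum := (hF.mul_left 2).add (hGs.mul_left 2)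
  have hs := Summable.of_nonneg_of_le (fun k => sq_nonneg _) hle hsum
  refine ⟨(mem_Sp_iff hd).2 hs, ?_⟩
  rw [normP_eq hd (r - 1 / 2), ← Real.sqrt_sq (normP_nonneg r u), ← Real.sqrt_mul (by positivity)]
  refine Real.sqrt_le_sqrt ((hs.tsum_le_tsum hle hsum).trans ?_)
  rw [(hF.mul_left 2).tsum_add (hGs.mul_left 2), tsum_mul_left, tsum_mul_left]
  linarith

/-- `∂_i` is skew-adjoint on `𝒮_q` up to an operator of order `-1/2`. -/
theorem innerP_partialD_add_le {d : ℕ} (hd : 1 ≤ d) (q : ℝ) :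
    ∃ C : ℝ, 0 ≤ C ∧ ∀ (i : Fin d) (u v : TDist d), u ∈ Sp d (q + 1 / 2) →
      v ∈ Sp d (q + 1 / 2) →
      |innerP q (partialD i u) v + innerP q u (partialD i v)|
        ≤ C * (normP q u * normP (q - 1 / 2) v) := by
  set K : ℝ := 2 * |2 * q| * 3 ^ |2 * q - 1|
  have hK : 0 ≤ K := by positivity
  refine ⟨K * 3 ^ |q| + K * 3 ^ |q - 1 / 2|, by positivity, fun i u v hu hv => ?_⟩
  have hN : ∀ k : Fin d → ℕ, 0 < freq k := fun k => zero_lt_one.trans_le (one_le_freq hd k)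
  have hu0 : u ∈ Sp d q := Sp_mono hd (by linarith) hu
  have hv0 : v ∈ Sp d q := Sp_mono hd (by linarith) hv
  have hv1 : v ∈ Sp d (q - 1 / 2) := Sp_mono hd (by linarith) hv
  obtain ⟨_, _, hD⟩ := partialD_mem_and_norm_le hd (q + 1 / 2)
  have hDu := (hD i u hu).1
  have hDv := (hD i v hv).1
  rw [add_sub_cancel_right] at hDu hDv
  set s : (Fin d → ℕ) → ℝ := fun k => Real.sqrt ((k i + 1 : ℕ) / 2)
  set X : (Fin d → ℕ) → ℝ := fun k => u (hermiteFn (k + Pi.single i 1)) * v (hermiteFn k)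
    with hX
  set Y : (Fin d → ℕ) → ℝ := fun k => v (hermiteFn (k + Pi.single i 1)) * u (hermiteFn k)
    with hY
  -- `F` gathers the raising terms and `G` the lowering ones. Reindexed by `k + e_i`, `G` becomes
  -- `F` with the weight taken at `k + e_i`, so only the increment of the weight survives.
  set F : (Fin d → ℕ) → ℝ := fun k => weight q k * s k * X k + weight q k * s k * Y k with hF
  set G : (Fin d → ℕ) → ℝ := fun k => weight q k * Real.sqrt (k i / 2)
    * (u (hermiteFn (k - Pi.single i 1)) * v (hermiteFn k)
      + u (hermiteFn k) * v (hermiteFn (k - Pi.single i 1))) with hGdef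
  have hsum : innerP q (partialD i u) v + innerP q u (partialD i v) = ∑' k, (F k - G k) := by
    unfold innerP
    rw [← (summable_innerP hDu hv0).tsum_add (summable_innerP hu0 hDv)]
    refine tsum_congr fun k => ?_
    rw [partialD_hermiteFn, partialD_hermiteFn]
    simp only [hF, hX, hY, hGdef, s]
    ring
  have hs0 : ∀ k, 0 ≤ s k := fun k => Real.sqrt_nonneg _
  have hFb : ∀ k, |weight q k * s k| ≤ 1 * freq k ^ (q + 1 / 2 + q) := by
    intro k
    rw [abs_of_nonneg (mul_nonneg (weight_nonneg _ _) (hs0 k)), weight_eq_sq hd,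
      Real.rpow_add (hN k), Real.rpow_add (hN k)]
    refine (mul_le_mul_of_nonneg_left (sqrt_succ_le k i) (sq_nonneg _)).trans (le_of_eq ?_)
    ring
  have hFs : Summable F := (shift_pairing hd zero_le_one i hFb hu hv0).1.add
    (shift_pairing hd zero_le_one i hFb hv hu0).1
  obtain ⟨hG1, hG2⟩ := summable_iff_and_tsum_shift (i := i) (G := G) (fun k hk => by
    simp [hGdef, hk])
  -- The increment has order `2q - 1` and the ladder coefficient order `1/2`; the total `2q - 1/2`
  -- is shared as `q` for `u` and `q - 1/2` for `v`.
  have hdb : ∀ k, |(weight q k - weight q (k + Pi.single i 1)) * s k|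
      ≤ K * freq k ^ (2 * q - 1 / 2) := by
    intro k
    rw [abs_mul, abs_of_nonneg (hs0 k)]
    have h1 : |weight q k - weight q (k + Pi.single i 1)| ≤ K * freq k ^ (2 * q - 1) := by
      change |freq k ^ (2 * q) - freq (k + Pi.single i 1) ^ (2 * q)| ≤ _
      rw [freq_add_single]
      exact abs_rpow_add_two_sub_le (one_le_freq hd k) _
    refine (mul_le_mul h1 (sqrt_succ_le k i) (hs0 k)
      (mul_nonneg hK (Real.rpow_nonneg (hN k).le _))).trans (le_of_eq ?_)
    rw [mul_assoc, ← Real.rpow_add (hN k)]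
    congr 2
    ring
  obtain ⟨hP1, hP2⟩ := shift_pairing (r := q) (t := q - 1 / 2) hd hK i
    (fun k => (hdb k).trans (le_of_eq (by congr 2; ring))) hu0 hv1
  -- Here the shifted factor is `v`, so the orders are exchanged to keep the weaker norm on `v`.
  obtain ⟨hQ1, hQ2⟩ := shift_pairing (r := q - 1 / 2) (t := q) hd hK i
    (fun k => (hdb k).trans (le_of_eq (by congr 2; ring))) hv1 hu0
  have hFG : ∀ k, F k - G (k + Pi.single i 1)
      = (weight q k - weight q (k + Pi.single i 1)) * s k * X k
        + (weight q k - weight q (k + Pi.single i 1)) * s k * Y k := by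
    intro k
    simp only [hF, hX, hY, hGdef, s, add_tsub_cancel_right, Pi.add_apply, Pi.single_eq_same]
    ring
  have hGs' : Summable fun k : Fin d → ℕ => G (k + Pi.single i 1) := by
    refine (hFs.sub (hP1.add hQ1)).congr fun k => ?_
    rw [← hFG]
    ring
  rw [hsum, hFs.tsum_sub (hG1.1 hGs'), ← hG2, ← hFs.tsum_sub hGs', tsum_congr hFG,
    hP1.tsum_add hQ1]
  refine (abs_add_le _ _).trans ((add_le_add hP2 hQ2).trans (le_of_eq ?_))
  ring

/-! ### The inequality in Hilbert space form -/

/-- The isometric embedding `u ↦ ((2|k| + d)^q ⟨u, h_k⟩)_k` of `𝒮_q` into `ℓ²`. -/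
noncomputable def toEllTwo {d : ℕ} (hd : 1 ≤ d) (q : ℝ) :
    Sp d q →ₗ[ℝ] lp (fun _ : Fin d → ℕ => ℝ) 2 where
  toFun u := ⟨fun k => freq k ^ q * (u : TDist d) (hermiteFn k), by
    refine memℓp_gen ?_
    simpa [← abs_mul] using (mem_Sp_iff hd).1 u.2⟩
  map_add' u v := by
    ext k
    change _ * ((u : TDist d) (hermiteFn k) + (v : TDist d) (hermiteFn k)) = _ * _ + _ * _
    ring
  map_smul' c u := by
    ext k
    change _ * (c * (u : TDist d) (hermiteFn k)) = c * (_ * _)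
    ring

theorem inner_toEllTwo {d : ℕ} (hd : 1 ≤ d) (q : ℝ) (u v : Sp d q) :
    inner ℝ (toEllTwo hd q u) (toEllTwo hd q v) = innerP q (u : TDist d) v := by
  rw [lp.inner_eq_tsum]
  refine tsum_congr fun k => ?_
  rw [weight_eq_sq hd]
  change (freq k ^ q * (v : TDist d) (hermiteFn k)) * (freq k ^ q * (u : TDist d) (hermiteFn k)) = _
  ring

theorem norm_toEllTwo {d : ℕ} (hd : 1 ≤ d) (q : ℝ) (u : Sp d q) :
    ‖toEllTwo hd q u‖ = normP q (u : TDist d) := by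
  rw [norm_eq_sqrt_real_inner, inner_toEllTwo]
  rfl

/-- Meant for `x = u`, `D = ∂u`, `D2 = ∂²u`, `V = ∂φ₂`, `V2 = ∂²φ₂`, with `σ`, `b` taken at `φ₂` and
`σ'`, `b'` at `φ₃`. No bound on `‖D i‖` or `‖D2 i j‖` is assumed: these vectors enter only through
`hmono`, `hD` and `hDV`. -/
theorem monotonicity_of_inner_bounds {H : Type*} [NormedAddCommGroup H] [InnerProductSpace ℝ H]
    {d n : ℕ} {σ σ' : Fin d → Fin n → ℝ} {b b' : Fin d → ℝ} {x : H} {D V : Fin d → H}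
    {D2 V2 : Fin d → Fin d → H} {y S B K Cm Λ : ℝ} (hy : 0 ≤ y) (hS : 0 ≤ S) (hB : 0 ≤ B)
    (hK : 0 ≤ K) (hCm : 0 ≤ Cm) (hΛ : 0 ≤ Λ) (hσ : ∀ i m, |σ i m| ≤ S)
    (hσ' : ∀ i m, |σ' i m| ≤ S) (hb : ∀ i, |b i| ≤ B) (hτ : ∀ i m, |σ' i m - σ i m| ≤ K * y)
    (hβ : ∀ i, |b' i - b i| ≤ K * y)
    (hmono : ∀ i j, |inner ℝ x (D2 i j) + inner ℝ (D i) (D j)| ≤ Cm * ‖x‖ ^ 2)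
    (hD : ∀ i, |inner ℝ x (D i)| ≤ Cm * ‖x‖ ^ 2) (hV : ∀ i, ‖V i‖ ≤ Λ)
    (hV2 : ∀ i j, ‖V2 i j‖ ≤ Λ) (hDV : ∀ i j, |inner ℝ (D i) (V j)| ≤ Λ * ‖x‖) :
    2 * inner ℝ x (((1 / 2 : ℝ) • (∑ i, ∑ j, (∑ m, σ' i m * σ' j m) • V2 i j)
        - ∑ i, b' i • V i)
      - ((1 / 2 : ℝ) • (∑ i, ∑ j, (∑ m, σ i m * σ j m) • (V2 i j - D2 i j))
        - ∑ i, b i • (V i - D i)))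
      + ∑ m, ‖(-∑ k, σ' k m • V k) - (-∑ k, σ k m • (V k - D k))‖ ^ 2
    ≤ (n * d * d * (S ^ 2 * Cm + 2 * S * K * Λ + K ^ 2 * Λ ^ 2)
        + d * (K * Λ + 2 * B * Cm)) * (‖x‖ ^ 2 + y ^ 2) := by
  set X := ‖x‖ with hXdef
  have hX : 0 ≤ X := norm_nonneg x
  -- The first summand is the cancelling pair. The second is the increment of `σ σᵗ`, split by the
  -- product rule; the others complete the expansion of the square.
  set T : Fin n → Fin d → Fin d → ℝ := fun m i j =>
    σ i m * σ j m * (inner ℝ x (D2 i j) + inner ℝ (D i) (D j))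
    + (σ' i m * (σ' j m - σ j m) + (σ' i m - σ i m) * σ j m) * inner ℝ x (V2 i j)
    + (σ' i m - σ i m) * σ j m * inner ℝ (V i) (D j)
    + σ i m * (σ' j m - σ j m) * inner ℝ (D i) (V j)
    + (σ' i m - σ i m) * (σ' j m - σ j m) * inner ℝ (V i) (V j) with hT
  set R : Fin d → ℝ := fun i =>
    -2 * ((b' i - b i) * inner ℝ x (V i)) - 2 * (b i * inner ℝ x (D i)) with hR
  have hA : ∀ m, ‖(-∑ k, σ' k m • V k) - (-∑ k, σ k m • (V k - D k))‖ ^ 2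
      = ∑ i, ∑ j, inner ℝ ((σ' i m - σ i m) • V i + σ i m • D i)
        ((σ' j m - σ j m) • V j + σ j m • D j) := by
    intro m
    have : (-∑ k, σ' k m • V k) - (-∑ k, σ k m • (V k - D k))
        = -∑ k, ((σ' k m - σ k m) • V k + σ k m • D k) := by
      rw [← neg_add', ← sub_eq_add_neg, ← Finset.sum_sub_distrib]
      congr 1
      refine Finset.sum_congr rfl fun k _ => ?_
      module
    rw [this, norm_neg, ← real_inner_self_eq_norm_sq, sum_inner]
    simp only [inner_sum]
  have hLvec : ((1 / 2 : ℝ) • (∑ i, ∑ j, (∑ m, σ' i m * σ' j m) • V2 i j)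
        - ∑ i, b' i • V i)
      - ((1 / 2 : ℝ) • (∑ i, ∑ j, (∑ m, σ i m * σ j m) • (V2 i j - D2 i j))
        - ∑ i, b i • (V i - D i))
      = (1 / 2 : ℝ) • (∑ m, ∑ i, ∑ j, ((σ' i m * σ' j m - σ i m * σ j m) • V2 i j
          + (σ i m * σ j m) • D2 i j))
        - ∑ i, ((b' i - b i) • V i + b i • D i) := by
    have e1 : ∑ m, ∑ i, ∑ j, ((σ' i m * σ' j m - σ i m * σ j m) • V2 i j
          + (σ i m * σ j m) • D2 i j)
        = ∑ i, ∑ j, (∑ m, σ' i m * σ' j m) • V2 i j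
          - ∑ i, ∑ j, (∑ m, σ i m * σ j m) • (V2 i j - D2 i j) := by
      rw [Finset.sum_comm, ← Finset.sum_sub_distrib]
      refine Finset.sum_congr rfl fun i _ => ?_
      rw [Finset.sum_comm, ← Finset.sum_sub_distrib]
      refine Finset.sum_congr rfl fun j _ => ?_
      rw [Finset.sum_smul, Finset.sum_smul, ← Finset.sum_sub_distrib]
      refine Finset.sum_congr rfl fun m _ => ?_
      module
    have e2 : ∑ i, ((b' i - b i) • V i + b i • D i)
        = ∑ i, b' i • V i - ∑ i, b i • (V i - D i) := by
      rw [← Finset.sum_sub_distrib]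
      refine Finset.sum_congr rfl fun i _ => ?_
      module
    rw [e1, e2, smul_sub]
    abel
  have hid : 2 * inner ℝ x (((1 / 2 : ℝ) • (∑ i, ∑ j, (∑ m, σ' i m * σ' j m) • V2 i j)
        - ∑ i, b' i • V i)
      - ((1 / 2 : ℝ) • (∑ i, ∑ j, (∑ m, σ i m * σ j m) • (V2 i j - D2 i j))
        - ∑ i, b i • (V i - D i)))
      + ∑ m, ‖(-∑ k, σ' k m • V k) - (-∑ k, σ k m • (V k - D k))‖ ^ 2
      = ∑ m, ∑ i, ∑ j, T m i j + ∑ i, R i := by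
    rw [hLvec, Finset.sum_congr rfl fun m _ => hA m, inner_sub_right, inner_smul_right, mul_sub,
      ← mul_assoc, show (2 : ℝ) * (1 / 2) = 1 by norm_num, one_mul, sub_add_eq_add_sub]
    simp only [inner_sum]
    rw [← Finset.sum_add_distrib, sub_eq_add_neg, Finset.mul_sum, ← Finset.sum_neg_distrib]
    congr 1
    · refine Finset.sum_congr rfl fun m _ => ?_
      rw [← Finset.sum_add_distrib]
      refine Finset.sum_congr rfl fun i _ => ?_
      rw [← Finset.sum_add_distrib]
      refine Finset.sum_congr rfl fun j _ => ?_
      simp only [hT, inner_add_left, inner_add_right, real_inner_smul_left, inner_smul_right]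
      ring
    · refine Finset.sum_congr rfl fun i _ => ?_
      simp only [hR, inner_add_right, inner_smul_right]
      ring
  have hKy : 0 ≤ K * y := mul_nonneg hK hy
  have habs : ∀ {a c e A C E : ℝ}, |a| ≤ A → |c| ≤ C → |e| ≤ E → a * c * e ≤ A * C * E := by
    intro a c e A C E ha hc he
    have hA0 := (abs_nonneg a).trans ha
    have hC0 := (abs_nonneg c).trans hc
    refine (le_abs_self _).trans ?_
    rw [abs_mul, abs_mul]
    gcongr
  have hinn : ∀ {v : H}, ‖v‖ ≤ Λ → |inner ℝ x v| ≤ X * Λ := fun hv =>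
    (abs_real_inner_le_norm _ _).trans (mul_le_mul_of_nonneg_left hv hX)
  have hyX : 2 * (X * y) ≤ X ^ 2 + y ^ 2 := by nlinarith [sq_nonneg (X - y)]
  have hTle : ∀ m i j, T m i j
      ≤ (S ^ 2 * Cm + 2 * S * K * Λ + K ^ 2 * Λ ^ 2) * (X ^ 2 + y ^ 2) := by
    intro m i j
    have t1 := habs (hσ i m) (hσ j m) (hmono i j)
    have t2 := habs (hσ' i m) (hτ j m) (hinn (hV2 i j))
    have t3 := habs (hτ i m) (hσ j m) (hinn (hV2 i j))
    have t4 := habs (hτ i m) (hσ j m) (real_inner_comm (V i) (D j) ▸ hDV j i)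
    have t5 := habs (hσ i m) (hτ j m) (hDV i j)
    have t6 := habs (hτ i m) (hτ j m) ((abs_real_inner_le_norm (V i) (V j)).trans
      (mul_le_mul (hV i) (hV j) (norm_nonneg _) hΛ))
    -- `t2` to `t5` each contribute `S K Λ X y`, and `2 X y ≤ X² + y²` turns the four into `2 S K Λ
    -- (X² + y²)`. `p1` and `p2` supply the missing squares for `t1` and `t6`.
    have p1 : 0 ≤ S ^ 2 * Cm * y ^ 2 := by positivity
    have p2 : 0 ≤ K ^ 2 * Λ ^ 2 * X ^ 2 := by positivity
    have p3 := mul_le_mul_of_nonneg_left hyX (show 0 ≤ 2 * S * K * Λ by positivity)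
    simp only [hT, add_mul _ _ (inner ℝ x (V2 i j))]
    linarith
  have hRle : ∀ i, R i ≤ (K * Λ + 2 * B * Cm) * (X ^ 2 + y ^ 2) := by
    intro i
    have t1 := habs ((abs_neg (1 : ℝ)).trans_le abs_one.le) (hβ i) (hinn (hV i))
    have t2 := habs ((abs_neg (1 : ℝ)).trans_le abs_one.le) (hb i) (hD i)
    have p1 : 0 ≤ B * Cm * y ^ 2 := by positivity
    have p3 := mul_le_mul_of_nonneg_left hyX (show 0 ≤ K * Λ by positivity)
    simp only [hR]
    linarith
  rw [hid, add_mul]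
  refine add_le_add ?_ ?_
  · refine (Finset.sum_le_sum fun m _ => Finset.sum_le_sum fun i _ =>
      Finset.sum_le_sum fun j _ => hTle m i j).trans (le_of_eq ?_)
    simp only [Finset.sum_const, Finset.card_univ, Fintype.card_fin, nsmul_eq_mul]
    ring
  · refine (Finset.sum_le_sum fun i _ => hRle i).trans (le_of_eq ?_)
    simp only [Finset.sum_const, Finset.card_univ, Fintype.card_fin, nsmul_eq_mul]
    ring

/-! ### The operators on the Hermite–Sobolev spaces -/

/-- The distributional derivative as a linear map. -/
noncomputable def partialDₗ {d : ℕ} (i : Fin d) : TDist d →ₗ[ℝ] TDist d where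
  toFun := partialD i
  map_add' u v := by
    unfold partialD
    rw [ContinuousLinearMap.add_comp, neg_add]
  map_smul' c u := by
    unfold partialD
    rw [ContinuousLinearMap.smul_comp, smul_neg]
    rfl

theorem partialD_mem {d : ℕ} (hd : 1 ≤ d) {r t : ℝ} (h : t ≤ r - 1 / 2) (i : Fin d)
    {u : TDist d} (hu : u ∈ Sp d r) : partialD i u ∈ Sp d t := by
  obtain ⟨_, _, h1⟩ := partialD_mem_and_norm_le hd r
  exact Sp_mono hd h (h1 i u hu).1

/-- `∂_i : 𝒮_p → 𝒮_q` for `q ≤ p - 1/2`. -/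
noncomputable def derivSp {d : ℕ} (hd : 1 ≤ d) {p q : ℝ} (h : q ≤ p - 1 / 2) (i : Fin d) :
    Sp d p →ₗ[ℝ] Sp d q :=
  (partialDₗ i).restrict fun _ hu => partialD_mem hd h i hu

section Operators

variable {d n : ℕ} (hd : 1 ≤ d) {p q : ℝ} (hq : q ≤ p - 1)

/-- `∂_i : 𝒮_p → 𝒮_q` for `q ≤ p - 1`. -/
noncomputable def firstDeriv (i : Fin d) : Sp d p →ₗ[ℝ] Sp d q :=
  derivSp hd (by linarith) i

/-- `∂²_{ij} : 𝒮_p → 𝒮_q` for `q ≤ p - 1`. -/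
noncomputable def secondDeriv (i j : Fin d) : Sp d p →ₗ[ℝ] Sp d q :=
  (derivSp (p := q + 1 / 2) hd (by linarith) i).comp (derivSp hd (by linarith) j)

theorem opL_eq_coe (σ : Fin d → Fin n → Sp d p → ℝ) (b : Fin d → Sp d p → ℝ) (φ ψ : Sp d p) :
    opL σ b φ ψ = (((1 / 2 : ℝ) • (∑ i, ∑ j, coeffA σ i j φ • secondDeriv hd hq i j ψ)
      - ∑ i, b i φ • firstDeriv hd hq i ψ : Sp d q) : TDist d) := by
  simp only [Submodule.coe_sub, Submodule.coe_smul, Submodule.coe_sum]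
  rfl

theorem opA_eq_coe (σ : Fin d → Fin n → Sp d p → ℝ) (i : Fin n) (φ ψ : Sp d p) :
    opA σ i φ ψ = ((-∑ k, σ k i φ • firstDeriv hd hq k ψ : Sp d q) : TDist d) := by
  simp only [Submodule.coe_neg, Submodule.coe_smul, Submodule.coe_sum]
  rfl

end Operators

theorem coeff_bounds_of_K₁_le {d n : ℕ} {p r : ℝ} {M : ℝ≥0} {σ : Fin d → Fin n → Sp d p → ℝ}
    {b : Fin d → Sp d p → ℝ} (h : K₁ σ b r ≤ M) {φ : Sp d p} (hφ : φ ∈ ballP d p r) :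
    (∀ i j, |σ i j φ| ≤ Real.sqrt M) ∧ ∀ i, |b i φ| ≤ M := by
  have h1 := (iSup₂_le_iff.1 h) φ hφ
  rw [max_le_iff] at h1
  simp only [iSup_le_iff] at h1
  refine ⟨fun i j => Real.le_sqrt_of_sq_le ?_, fun i => ?_⟩
  · have := h1.1 i j
    rwa [ENNReal.ofReal_le_coe] at this
  · have := h1.2 i
    rwa [ENNReal.ofReal_le_coe] at this

end HermiteSobolev

/-! ### The monotonicity inequality -/

theorem theorem3p3 (d n : ℕ) (hd : 1 ≤ d) (p q : ℝ) (hq : q ≤ p - 1) :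
    (∀ (σ : Fin d → Fin n → Sp d p → ℝ) (b : Fin d → Sp d p → ℝ) (φ ψ : Sp d p),
      opL σ b φ ψ ∈ Sp d q ∧ ∀ i, opA σ i φ ψ ∈ Sp d q) ∧
    ∀ (lam K : ℝ), 0 < lam → 0 < K → ∀ M : ℝ≥0,
      ∃ C : ℝ, 0 < C ∧
        ∀ (σ : Fin d → Fin n → Sp d p → ℝ) (b : Fin d → Sp d p → ℝ),
          LipschitzOnBall q lam K σ b → K₁ σ b lam ≤ M →
          ∀ φ₁ ∈ ballP d p lam, ∀ φ₂ ∈ ballP d p lam, ∀ φ₃ ∈ ballP d p lam,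
            2 * innerP q ((φ₂ - φ₁ : Sp d p) : TDist d) (opL σ b φ₃ φ₂ - opL σ b φ₂ φ₁)
              + ∑ i, normP q (opA σ i φ₃ φ₂ - opA σ i φ₂ φ₁) ^ 2
            ≤ C * (normP q ((φ₂ - φ₁ : Sp d p) : TDist d) ^ 2 + normP q ((φ₂ - φ₃ : Sp d p) : TDist d) ^ 2) := by
  refine ⟨fun σ b φ ψ => ⟨?_, fun i => ?_⟩, fun lam K hlam hK M => ?_⟩
  · rw [opL_eq_coe hd hq]
    exact Subtype.coe_prop _
  · rw [opA_eq_coe hd hq]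
    exact Subtype.coe_prop _
  obtain ⟨Cs, hCs, hskew⟩ := innerP_partialD_add_le hd q
  obtain ⟨C₀, hC₀, hder₀⟩ := partialD_mem_and_norm_le hd q
  obtain ⟨C₁, hC₁, hder₁⟩ := partialD_mem_and_norm_le hd (q + 1 / 2)
  obtain ⟨C₂, hC₂, hder₂⟩ := partialD_mem_and_norm_le hd (q + 1)
  rw [add_sub_cancel_right] at hder₁
  rw [show q + 1 - 1 / 2 = q + 1 / 2 by ring] at hder₂
  -- The summands bound `∂φ₂`, `∂²φ₂` and the skew-adjointness defect paired with `∂φ₂`. In `Cm`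
  -- below, `Cs * C₀` serves the second-order pair and `Cs` the drift.
  set Λ : ℝ := (C₁ + C₁ * C₂ + Cs * C₁) * lam with hΛdef
  have hΛ : 0 ≤ Λ := by positivity
  set Cm : ℝ := Cs * C₀ + Cs with hCmdef
  have hCm : 0 ≤ Cm := by positivity
  set C : ℝ := n * d * d * (Real.sqrt M ^ 2 * Cm + 2 * Real.sqrt M * K * Λ + K ^ 2 * Λ ^ 2)
        + d * (K * Λ + 2 * M * Cm) with hCdef
  have hC : 0 ≤ C := by positivity
  -- `C` is only known to be nonnegative, and the constant must be positive.
  refine ⟨C + 1, by linarith, fun σ b hLip hK₁ φ₁ hφ₁ φ₂ hφ₂ φ₃ hφ₃ => ?_⟩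
  obtain ⟨hσ, hb⟩ := coeff_bounds_of_K₁_le hK₁ hφ₂
  obtain ⟨hσ', _⟩ := coeff_bounds_of_K₁_le hK₁ hφ₃
  obtain ⟨hτ, hβ⟩ := hLip φ₂ hφ₂ φ₃ hφ₃
  have hmem : ∀ {t : ℝ}, t ≤ p → ∀ φ : Sp d p, (φ : TDist d) ∈ Sp d t := fun ht φ =>
    Sp_mono hd ht φ.2
  have hball : ∀ {t : ℝ}, t ≤ p → normP t (φ₂ : TDist d) ≤ lam := fun ht =>
    (normP_mono hd ht φ₂.2).trans hφ₂
  set u : Sp d p := φ₂ - φ₁ with hu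
  set X : ℝ := normP q (u : TDist d) with hX
  have hX0 : 0 ≤ X := normP_nonneg _ _
  set y : ℝ := normP q ((φ₂ - φ₃ : Sp d p) : TDist d) with hy
  set x : Sp d q := ⟨u, hmem (by linarith) u⟩ with hx
  set J := toEllTwo hd q with hJ
  have hJx : ‖J x‖ = X := norm_toEllTwo hd q x
  have hφ₁eq : φ₁ = φ₂ - u := by rw [hu]; abel
  have hV : ∀ i, normP q (partialD i (φ₂ : TDist d)) ≤ C₁ * lam := fun i =>
    (hder₁ i _ (hmem (by linarith) φ₂)).2.trans
      (mul_le_mul_of_nonneg_left (hball (by linarith)) hC₁)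
  have hV2 : ∀ i j, normP q (partialD i (partialD j (φ₂ : TDist d))) ≤ C₁ * (C₂ * lam) :=
    fun i j => by
      obtain ⟨h1, h2⟩ := hder₂ j _ (hmem (by linarith) φ₂)
      exact (hder₁ i _ h1).2.trans (mul_le_mul_of_nonneg_left
        (h2.trans (mul_le_mul_of_nonneg_left (hball (by linarith)) hC₂)) hC₁)
  have hmain := monotonicity_of_inner_bounds (σ := fun i m => σ i m φ₂)
    (σ' := fun i m => σ i m φ₃) (b := fun i => b i φ₂) (b' := fun i => b i φ₃) (x := J x)
    (D := fun i => J (firstDeriv hd hq i u)) (V := fun i => J (firstDeriv hd hq i φ₂))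
    (D2 := fun i j => J (secondDeriv hd hq i j u)) (V2 := fun i j => J (secondDeriv hd hq i j φ₂))
    (y := y) (S := Real.sqrt M) (B := M) (K := K) (Cm := Cm) (Λ := Λ) (normP_nonneg _ _)
    (Real.sqrt_nonneg _) M.2 hK.le hCm hΛ hσ hσ' hb
    (fun i m => by rw [abs_sub_comm]; exact hτ i m)
    (fun i => by rw [abs_sub_comm]; exact hβ i)
    (fun i j => by
      rw [hJx, inner_toEllTwo, inner_toEllTwo]
      change |innerP q (u : TDist d) (partialD i (partialD j (u : TDist d)))
        + innerP q (partialD i (u : TDist d)) (partialD j (u : TDist d))| ≤ _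
      rw [add_comm]
      -- Near skew-adjointness with `v = ∂_j u`, which must lie in `𝒮_{q+1/2}`: this uses the full
      -- strength of `q ≤ p - 1`.
      refine (hskew i _ _ (hmem (by linarith) u)
        (partialD_mem hd (by linarith) j u.2)).trans ?_
      have h := mul_le_mul_of_nonneg_left (mul_le_mul_of_nonneg_left
        (hder₀ j _ (hmem (by linarith) u)).2 hX0) hCs
      refine h.trans ?_
      rw [← hX, hCmdef]
      linarith [mul_nonneg hCs (sq_nonneg X)])
    (fun i => by
      rw [hJx, inner_toEllTwo]
      change |innerP q (u : TDist d) (partialD i (u : TDist d))| ≤ _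
      have h := hskew i u u (hmem (by linarith) u) (hmem (by linarith) u)
      have hcomm : innerP q (partialD i (u : TDist d)) (u : TDist d)
          = innerP q (u : TDist d) (partialD i (u : TDist d)) :=
        tsum_congr fun k => by ring
      -- With `v = u` the two pairings coincide, so the defect bounds `2 ⟨u, ∂_i u⟩_q`.
      rw [hcomm, ← two_mul, abs_mul, abs_two] at h
      have h2 := mul_le_mul_of_nonneg_left (mul_le_mul_of_nonneg_left
        (normP_mono hd (show q - 1 / 2 ≤ q by linarith) (hmem (by linarith) u)) hX0) hCs
      have h3 := abs_nonneg (innerP q (u : TDist d) (partialD i (u : TDist d)))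
      rw [← hX] at h h2
      rw [hCmdef]
      linarith [mul_nonneg (mul_nonneg hCs hC₀) (sq_nonneg X)])
    (fun i => by
      rw [norm_toEllTwo]
      refine (hV i).trans ?_
      rw [hΛdef]
      gcongr
      linarith [mul_nonneg hC₁ hC₂, mul_nonneg hCs hC₁])
    (fun i j => by
      rw [norm_toEllTwo]
      refine (hV2 i j).trans ?_
      rw [hΛdef, ← mul_assoc]
      gcongr
      linarith [mul_nonneg hC₁ hC₂, mul_nonneg hCs hC₁])
    (fun i j => by
      have hCS := abs_real_inner_le_norm (J x) (J (secondDeriv hd hq i j φ₂))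
      rw [inner_toEllTwo, norm_toEllTwo, norm_toEllTwo] at hCS
      rw [hJx, inner_toEllTwo]
      change |innerP q (u : TDist d) (partialD i (partialD j (φ₂ : TDist d)))|
        ≤ X * normP q (partialD i (partialD j (φ₂ : TDist d))) at hCS
      change |innerP q (partialD i (u : TDist d)) (partialD j (φ₂ : TDist d))| ≤ _
      -- `∂_i` is moved from `u` to `∂_j φ₂`; the resulting `⟨u, ∂_i ∂_j φ₂⟩_q` is bounded by
      -- Cauchy–Schwarz in `hCS`.
      have h := hskew i _ _ (hmem (by linarith) u)
        (partialD_mem hd (t := q + 1 / 2) (by linarith) j φ₂.2)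
      have h2 : normP (q - 1 / 2) (partialD j (φ₂ : TDist d)) ≤ C₁ * lam :=
        (normP_mono hd (by linarith) (hder₁ j _ (hmem (by linarith) φ₂)).1).trans (hV j)
      have h3 := mul_le_mul_of_nonneg_left (mul_le_mul_of_nonneg_left h2 hX0) hCs
      have h4 := hCS.trans (mul_le_mul_of_nonneg_left (hV2 i j) hX0)
      have h5 := abs_sub (innerP q (partialD i (u : TDist d)) (partialD j (φ₂ : TDist d))
        + innerP q (u : TDist d) (partialD i (partialD j (φ₂ : TDist d))))
        (innerP q (u : TDist d) (partialD i (partialD j (φ₂ : TDist d))))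
      rw [add_sub_cancel_right] at h5
      have h6 : 0 ≤ C₁ * lam * X := by positivity
      rw [hΛdef]
      linarith)
  rw [hJx, ← hCdef] at hmain
  have hL : innerP q (u : TDist d) (opL σ b φ₃ φ₂ - opL σ b φ₂ φ₁)
      = inner ℝ (J x) (J ((((1 / 2 : ℝ) • (∑ i, ∑ j, coeffA σ i j φ₃ • secondDeriv hd hq i j φ₂)
        - ∑ i, b i φ₃ • firstDeriv hd hq i φ₂))
        - ((1 / 2 : ℝ) • (∑ i, ∑ j, coeffA σ i j φ₂ • secondDeriv hd hq i j φ₁)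
        - ∑ i, b i φ₂ • firstDeriv hd hq i φ₁))) := by
    rw [opL_eq_coe hd hq, opL_eq_coe hd hq, ← Submodule.coe_sub, inner_toEllTwo]
  have hA : ∀ i, normP q (opA σ i φ₃ φ₂ - opA σ i φ₂ φ₁)
      = ‖J ((-∑ k, σ k i φ₃ • firstDeriv hd hq k φ₂)
        - (-∑ k, σ k i φ₂ • firstDeriv hd hq k φ₁))‖ := by
    intro i
    rw [opA_eq_coe hd hq, opA_eq_coe hd hq, ← Submodule.coe_sub, norm_toEllTwo]
  have hfin : 2 * innerP q (u : TDist d) (opL σ b φ₃ φ₂ - opL σ b φ₂ φ₁)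
      + ∑ i, normP q (opA σ i φ₃ φ₂ - opA σ i φ₂ φ₁) ^ 2 ≤ C * (X ^ 2 + y ^ 2) := by
    refine le_of_eq_of_le ?_ hmain
    simp only [hL, hA]
    rw [hφ₁eq]
    have hJsub : ∀ v w : Sp d q, J (v - w) = J v - J w := fun v w => map_sub J v w
    have hJneg : ∀ v : Sp d q, J (-v) = -J v := fun v => map_neg J v
    have h1sub : ∀ (i : Fin d) (v w : Sp d p), firstDeriv hd hq i (v - w)
        = firstDeriv hd hq i v - firstDeriv hd hq i w := fun i v w =>
      map_sub (firstDeriv hd hq i) v w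
    have h2sub : ∀ (i j : Fin d) (v w : Sp d p), secondDeriv hd hq i j (v - w)
        = secondDeriv hd hq i j v - secondDeriv hd hq i j w := fun i j v w =>
      map_sub (secondDeriv hd hq i j) v w
    simp only [hJsub, hJneg, h1sub, h2sub, map_sum, LinearMap.map_smul, coeffA]
  refine hfin.trans (mul_le_mul_of_nonneg_right (by linarith) (by positivity))
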